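/- Let $X$ be a smooth projective (irreducible) curve over an algebraically closed field (for instance over $\mathbb{C}$), let $N$ be a line bundle on $X$, let $b,c\in\mathbb{N}$, and let $(E,\varphi)$ be a decorated vector bundle of type $(2,b,c,N)$, that is, a vector bundle $E$ on $X$ together with a nonzero morphism $$\varphi\colon (E\otimes E)^{\oplus b}\to(\det E)^{\otimes c}\otimes N .$$ Put $r=\operatorname{rk}E$. A weighted filtration $(E^\bullet,\underline\alpha)$ of $E$ of length $t\ge 1$ consists of subbundles $0\subsetneq E_1\subsetneq\dots\subsetneq E_t\subsetneq E$ (locally free subsheaves with locally free quotient) and positive rational weights $\underline\alpha=(\alpha_1,\dots,\alpha_t)$. Put $E_{t+1}=E$, let $\gamma=(\gamma_1,\dots,\gamma_r)$ be the vector $$\gamma=\sum_{i=1}^t\alpha_i\,(\underbrace{\operatorname{rk}E_i-r,\dots,\operatorname{rk}E_i-r}_{\operatorname{rk}E_i},\underbrace{\operatorname{rk}E_i,\dots,\operatorname{rk}E_i}_{r-\operatorname{rk}E_i}),$$ and define $$P(E^\bullet,\underline\alpha)=\sum_{i=1}^t\alpha_i\,(\deg E\,\operatorname{rk}E_i-r\deg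 E_i),$$ $$\mu(E^\bullet,\underline\alpha;\varphi)=-\min\{\gamma_{\operatorname{rk}E_i}+\gamma_{\operatorname{rk}E_j}\;:\;1\le i,j\le t+1,\ \varphi|_{(E_i\otimes E_j)^{\oplus b}}\not\equiv 0\}.$$ Fix $\delta\in\mathbb{Q}_{>0}$. The pair $(E,\varphi)$ is called semistable (respectively stable) if $P(E^\bullet,\underline\alpha)+\delta\,\mu(E^\bullet,\underline\alpha;\varphi)\ge 0$ (respectively $>0$) for every weighted filtration of $E$. Theorem. $(E,\varphi)$ is semistable if and only if $P(E^\bullet,\underline 1)+\delta\,\mu(E^\bullet,\underline 1;\varphi)\ge 0$ for every filtration $E^\bullet$ of $E$ of length $1$ or $2$, where all weights are equal to $1$. Likewise, $(E,\varphi)$ is stable if and only if $P(E^\bullet,\underline 1)+\delta\,\mu(E^\bullet,\underline 1;\varphi)> 0$ for every filtration $E^\bullet$ of $E$ of length $1$ or $2$, where all weights are equal to $1$. -/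

import Mathlib

open CategoryTheory Limits AlgebraicGeometry

universe u v₁ u₁

noncomputable section

/-! ### Exterior powers of presheaves of modules -/

namespace PresheafOfModules

variable {C : Type u₁} [Category.{v₁} C] {R : Cᵒᵖ ⥤ CommRingCat.{u}}

/-- The restriction map `⋀ⁿ M(U) ⟶ ⋀ⁿ M(V)`, `m₁ ∧ ⋯ ∧ mₙ ↦ m₁|_V ∧ ⋯ ∧ mₙ|_V`. -/
def exteriorPowerMap (M : PresheafOfModules.{u} (R ⋙ forget₂ CommRingCat RingCat)) (n : ℕ)
    {U V : Cᵒᵖ} (f : U ⟶ V) :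
    ModuleCat.exteriorPower (R := R.obj U) (M.obj U) n ⟶
      (ModuleCat.restrictScalars (R.map f).hom).obj
        (ModuleCat.exteriorPower (R := R.obj V) (M.obj V) n) :=
  ModuleCat.exteriorPower.desc (R := R.obj U)
    (AlternatingMap.mk (R := R.obj U) (M := M.obj U) (ι := Fin n)
      (N := (ModuleCat.restrictScalars (R.map f).hom).obj
        (ModuleCat.exteriorPower (R := R.obj V) (M.obj V) n))
      { toFun := fun m => exteriorPower.ιMulti (R.obj V) n (fun i => (M.map f (m i) : M.obj V))
        map_update_add' := by
          intro _ m i x y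
          have h : ∀ z : M.obj U,
              (fun j => (M.map f (Function.update m i z j) : M.obj V)) =
                Function.update (fun j => (M.map f (m j) : M.obj V)) i (M.map f z) := by
            intro z
            funext j
            by_cases hj : j = i
            · subst hj; simp
            · simp [Function.update_of_ne hj]
          rw [h, h, h, map_add]
          exact (exteriorPower.ιMulti (R.obj V) n).map_update_add _ _ _ _
        map_update_smul' := by
          intro _ m i r x
          have h : ∀ z : M.obj U,
              (fun j => (M.map f (Function.update m i z j) : M.obj V)) =
                Function.update (fun j => (M.map f (m j) : M.obj V)) i (M.map f z) := by
            intro z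
            funext j
            by_cases hj : j = i
            · subst hj; simp
            · simp [Function.update_of_ne hj]
          rw [h, h]
          have e : (M.map f (r • x) : M.obj V) = ((R.map f).hom r) • (M.map f x : M.obj V) :=
            PresheafOfModules.map_smul M f r x
          rw [e]
          exact (exteriorPower.ιMulti (R.obj V) n).map_update_smul _ _ _ _ }
      (by
        intro m i j h hij
        refine (exteriorPower.ιMulti (R.obj V) n).map_eq_zero_of_eq _ ?_ hij
        change (M.map f (m i) : M.obj V) = M.map f (m j)
        rw [h]))

/-- The presheaf of modules `U ↦ ⋀ⁿ M(U)`. -/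
def exteriorPower (M : PresheafOfModules.{u} (R ⋙ forget₂ CommRingCat RingCat)) (n : ℕ) :
    PresheafOfModules.{u} (R ⋙ forget₂ CommRingCat RingCat) where
  obj U := ModuleCat.exteriorPower (R := R.obj U) (M.obj U) n
  map f := exteriorPowerMap M n f
  map_id U := by
    apply ModuleCat.exteriorPower.hom_ext
    ext x
    refine (ModuleCat.exteriorPower.desc_mk _ x).trans ?_
    change exteriorPower.ιMulti (R.obj U) n (M := M.obj U)
        (fun i => (M.map (𝟙 U) (x i) : M.obj U)) =
      exteriorPower.ιMulti (R.obj U) n (M := M.obj U) x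
    congr 1
    funext i
    rw [M.map_id]
    rfl
  map_comp {U V W} f g := by
    apply ModuleCat.exteriorPower.hom_ext
    ext x
    refine (ModuleCat.exteriorPower.desc_mk _ x).trans ?_
    change _ = exteriorPowerMap M n g (exteriorPowerMap M n f (ModuleCat.exteriorPower.mk x))
    erw [ModuleCat.exteriorPower.desc_mk]
    change _ = exteriorPowerMap M n g (ModuleCat.exteriorPower.mk (R := R.obj V)
      (M := M.obj V) (fun i => (M.map f (x i) : M.obj V)))
    erw [ModuleCat.exteriorPower.desc_mk]
    change exteriorPower.ιMulti (R.obj W) n (fun i => (M.map (f ≫ g) (x i) : M.obj W)) =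
      exteriorPower.ιMulti (R.obj W) n (fun i => (M.map g (M.map f (x i)) : M.obj W))
    congr 1
    funext i
    exact M.map_comp_apply f g (x i)

end PresheafOfModules

namespace Decorated

/-! ### Smooth projective curves -/

section Curves

attribute [local instance] MvPolynomial.gradedAlgebra

/-- Projective `n`-space over the field `k`: `Proj k[x₀, …, xₙ]`. -/
def projSpace (k : Type u) [Field k] (n : ℕ) : Scheme.{u} :=
  Proj (MvPolynomial.homogeneousSubmodule (Fin (n + 1)) k)

/-- The structure morphism of projective space. -/
def projSpaceStr (k : Type u) [Field k] (n : ℕ) : projSpace k n ⟶ Spec (CommRingCat.of k) :=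
  Proj.toSpecZero (MvPolynomial.homogeneousSubmodule (Fin (n + 1)) k) ≫
    Spec.map (CommRingCat.ofHom
      (algebraMap k (MvPolynomial.homogeneousSubmodule (Fin (n + 1)) k 0)))

end Curves

/-- A smooth projective (irreducible) curve over the field `k`. -/
structure SmoothProjectiveCurve (k : Type u) [Field k] where
  X : Scheme.{u}
  str : X ⟶ Spec (CommRingCat.of k)
  isIntegral : IsIntegral X
  smooth : SmoothOfRelativeDimension 1 str
  projective : ∃ (n : ℕ) (i : X ⟶ projSpace k n),
    IsClosedImmersion i ∧ i ≫ projSpaceStr k n = str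

instance {k : Type u} [Field k] (C : SmoothProjectiveCurve k) : IsIntegral C.X := C.isIntegral

instance {k : Type u} [Field k] (C : SmoothProjectiveCurve k) : IsLocallyNoetherian C.X := by
  have := C.smooth
  have : Smooth C.str := SmoothOfRelativeDimension.smooth 1 C.str
  exact LocallyOfFiniteType.isLocallyNoetherian C.str

/-! ### Multilinear algebra of sheaves of modules -/

section Modules

variable {X : Scheme.{u}}

instance : HasFiniteBiproducts X.Modules := Abelian.hasFiniteBiproducts

/-- Presheaves of `𝒪_X`-modules, where `𝒪_X` is remembered to be a presheaf of commutative rings. -/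
abbrev PreMod (X : Scheme.{u}) :=
  PresheafOfModules.{u} (X.presheaf ⋙ forget₂ CommRingCat RingCat.{u})

/-- The presheaf of modules underlying a sheaf of modules. -/
abbrev toPreMod (X : Scheme.{u}) : X.Modules ⥤ PreMod X := Scheme.Modules.toPresheafOfModules X

/-- The sheaf of modules associated with a presheaf of modules. -/
def sheafify (X : Scheme.{u}) : PreMod X ⥤ X.Modules :=
  show X.PresheafOfModules ⥤ X.Modules from
    PresheafOfModules.sheafification (𝟙 X.ringCatSheaf.obj)

/-- The tensor product `M ⊗ N` of sheaves of modules: the sheaf associated with the presheaf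
`U ↦ M(U) ⊗ N(U)`. -/
def tensor (M N : X.Modules) : X.Modules :=
  (sheafify X).obj (MonoidalCategory.tensorObj (C := PreMod X)
    ((toPreMod X).obj M) ((toPreMod X).obj N))

/-- The morphism `f ⊗ g : M ⊗ N ⟶ M' ⊗ N'`. -/
def tensorMap {M M' N N' : X.Modules} (f : M ⟶ M') (g : N ⟶ N') : tensor M N ⟶ tensor M' N' :=
  (sheafify X).map (MonoidalCategory.tensorHom (C := PreMod X)
    ((toPreMod X).map f) ((toPreMod X).map g))

lemma tensorMap_id (M N : X.Modules) : tensorMap (𝟙 M) (𝟙 N) = 𝟙 (tensor M N) := by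
  unfold tensorMap tensor
  rw [CategoryTheory.Functor.map_id, CategoryTheory.Functor.map_id,
    MonoidalCategory.id_tensorHom_id, CategoryTheory.Functor.map_id]

/-- The tensor power `M^{⊗ n}`, with `M^{⊗ 0} = 𝒪_X`. -/
def tensorPow (M : X.Modules) : ℕ → X.Modules
  | 0 => SheafOfModules.unit X.ringCatSheaf
  | n + 1 => tensor (tensorPow M n) M

/-- The exterior power `⋀ⁿ M`: the sheaf associated with the presheaf `U ↦ ⋀ⁿ M(U)`. -/
def exteriorPow (M : X.Modules) (n : ℕ) : X.Modules :=
  (sheafify X).obj (PresheafOfModules.exteriorPower ((toPreMod X).obj M) n)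

/-- The free sheaf of modules `𝒪_X^{⊕ n}`. -/
def freeModule (X : Scheme.{u}) (n : ℕ) : X.Modules :=
  SheafOfModules.free (R := X.ringCatSheaf) (ULift.{u} (Fin n))

/-- `M` is locally free of rank `n`. -/
def IsLocallyFreeOfRank (M : X.Modules) (n : ℕ) : Prop :=
  ∀ x : X, ∃ U : X.Opens, x ∈ U ∧ Nonempty (M.restrict U.ι ≅ freeModule (U : Scheme.{u}) n)

end Modules

/-! ### Degree -/

section Degree

variable {X : Scheme.{u}} [IsIntegral X] [IsLocallyNoetherian X]

/-- Restriction of sections. -/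
def res {M : X.Modules} {V W : X.Opens} (h : W ≤ V) (s : Γ(M, V)) : Γ(M, W) :=
  M.presheaf.map (homOfLE h).op s

/-- The section `e` over `V` is a generator (nowhere vanishing section) of the line bundle `L`,
that is, `f ↦ f • e` is an isomorphism from `𝒪_V` to the restriction of `L`. -/
def IsGenerator {L : X.Modules} {V : X.Opens} (e : Γ(L, V)) : Prop :=
  ∀ (W : X.Opens) (h : W ≤ V), Function.Bijective fun f : Γ(X, W) => f • res h e

/-- The order of vanishing at `x` of the rational section of the line bundle `L` given by
the section `s` over the nonempty open set `U`: it is `ord_x f` if `s = f • e`, with `e`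
a generator of `L` near `x` and `f` a rational function. -/
def sectionOrd {L : X.Modules} {U : X.Opens} (s : Γ(L, U)) (x : X) : ℤ :=
  Classical.epsilon fun n : ℤ =>
    ∃ (V : X.Opens) (e : Γ(L, V)) (f : Γ(X, U ⊓ V)) (h : genericPoint X ∈ U ⊓ V),
      x ∈ V ∧ IsGenerator e ∧ res inf_le_left s = f • res inf_le_right e ∧
        Scheme.ord (X.presheaf.germ (U ⊓ V) (genericPoint X) h f) x = n

/-- The degree of a line bundle `L` (on a smooth projective curve over an algebraically closed
field): the number of zeros minus the number of poles of a nonzero rational section of `L`. -/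
def lineDegree (L : X.Modules) : ℤ :=
  Classical.epsilon fun d : ℤ =>
    ∃ (U : X.Opens) (s : Γ(L, U)), genericPoint X ∈ U ∧ s ≠ 0 ∧ d = ∑ᶠ x : X, sectionOrd s x

end Degree

/-! ### Vector bundles, subbundles, filtrations -/

section Bundles

variable {X : Scheme.{u}}

/-- A vector bundle (of constant rank): a locally free sheaf of finite rank. -/
structure VectorBundle (X : Scheme.{u}) where
  sheaf : X.Modules
  rank : ℕ
  locallyFree : IsLocallyFreeOfRank sheaf rank

/-- The determinant line bundle `det E`, the top exterior power of `E`. -/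
def VectorBundle.det (E : VectorBundle X) : X.Modules := exteriorPow E.sheaf E.rank

/-- The degree of a vector bundle. -/
def VectorBundle.degree [IsIntegral X] [IsLocallyNoetherian X] (E : VectorBundle X) : ℤ :=
  lineDegree E.det

/-- A subbundle of `E`: a locally free subsheaf with locally free quotient. -/
structure Subbundle (E : VectorBundle X) extends VectorBundle X where
  incl : sheaf ⟶ E.sheaf
  mono : Mono incl
  quotient_locallyFree : ∃ n : ℕ, IsLocallyFreeOfRank (cokernel incl) n

/-- Inclusion of subbundles of `E`. -/
def Subbundle.IsContainedIn {E : VectorBundle X} (F G : Subbundle E) : Prop :=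
  ∃ h : F.sheaf ⟶ G.sheaf, h ≫ G.incl = F.incl

/-- A filtration `0 ⊊ E₁ ⊊ ⋯ ⊊ E_t ⊊ E` of length `t` by subbundles. For nested subbundles of
a bundle on a connected curve, proper inclusion means that the rank is strictly smaller. -/
structure Filtration (E : VectorBundle X) (t : ℕ) where
  sub : Fin t → Subbundle E
  mono : ∀ i j, i ≤ j → (sub i).IsContainedIn (sub j)
  rank_pos : ∀ i, 0 < (sub i).rank
  rank_strictMono : StrictMono fun i => (sub i).rank
  rank_lt : ∀ i, (sub i).rank < E.rank

namespace Filtration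

variable {E : VectorBundle X} {t : ℕ} (F : Filtration E t)

/-- The members of the filtration, including `E` itself (which has the index `none`). -/
def obj : Option (Fin t) → X.Modules
  | none => E.sheaf
  | some i => (F.sub i).sheaf

/-- The inclusion of a member of the filtration into `E`. -/
def incl : (i : Option (Fin t)) → (F.obj i ⟶ E.sheaf)
  | none => 𝟙 E.sheaf
  | some i => (F.sub i).incl

/-- The ranks of the members of the filtration. -/
def rk : Option (Fin t) → ℕ
  | none => E.rank
  | some i => (F.sub i).rank

/-- The `k`-th component (`1 ≤ k ≤ rk E`) of the weight vector
`γ = ∑ᵢ αᵢ (rk Eᵢ - r, …, rk Eᵢ - r, rk Eᵢ, …, rk Eᵢ)`, where `r = rk E` and the entry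
`rk Eᵢ - r` occurs `rk Eᵢ` times. -/
def gamma (α : Fin t → ℚ) (k : ℕ) : ℚ :=
  ∑ i, α i * (if k ≤ (F.sub i).rank then ((F.sub i).rank : ℚ) - E.rank else (F.sub i).rank)

/-- `P(E•, α) = ∑ᵢ αᵢ (deg E rk Eᵢ - rk E deg Eᵢ)`. -/
def P [IsIntegral X] [IsLocallyNoetherian X] (α : Fin t → ℚ) : ℚ :=
  ∑ i, α i * ((E.degree : ℚ) * (F.sub i).rank - E.rank * (F.sub i).degree)

end Filtration

end Bundles

/-! ### Decorated vector bundles -/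

section DecoratedBundles

variable {X : Scheme.{u}}

/-- A decorated vector bundle of type `(2, b, c, N)`: a vector bundle `E` with a nonzero morphism
`φ : (E ⊗ E)^{⊕ b} ⟶ (det E)^{⊗ c} ⊗ N`. -/
structure DecoratedBundle (X : Scheme.{u}) (b c : ℕ) (N : X.Modules) where
  E : VectorBundle X
  φ : (⨁ fun _ : Fin b => tensor E.sheaf E.sheaf) ⟶ tensor (tensorPow E.det c) N
  φ_ne_zero : φ ≠ 0

namespace DecoratedBundle

variable {b c : ℕ} {N : X.Modules} (D : DecoratedBundle X b c N) {t : ℕ}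

/-- The restriction of `φ` to `(Eᵢ ⊗ Eⱼ)^{⊕ b}`. -/
def restr (F : Filtration D.E t) (i j : Option (Fin t)) :
    (⨁ fun _ : Fin b => tensor (F.obj i) (F.obj j)) ⟶ tensor (tensorPow D.E.det c) N :=
  biproduct.map (fun _ => tensorMap (F.incl i) (F.incl j)) ≫ D.φ

lemma restr_none_ne_zero (F : Filtration D.E t) : D.restr F none none ≠ 0 := by
  have h : D.restr F none none = D.φ := by
    change biproduct.map (fun _ => tensorMap (𝟙 D.E.sheaf) (𝟙 D.E.sheaf)) ≫ D.φ = D.φ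
    have e : biproduct.map (fun _ : Fin b => tensorMap (𝟙 D.E.sheaf) (𝟙 D.E.sheaf)) = 𝟙 _ := by
      apply biproduct.hom_ext
      intro j
      rw [biproduct.map_π, tensorMap_id, Category.comp_id, Category.id_comp]
    rw [e, Category.id_comp]
  rw [h]
  exact D.φ_ne_zero

open Classical in
/-- `μ(E•, α; φ) = - min {γ^{(i)} + γ^{(j)} | φ is not identically zero on (Eᵢ ⊗ Eⱼ)^{⊕ b}}`, where
`Eᵢ`, `Eⱼ` run through the members of the filtration (including `E`) and `γ^{(i)}` is
the component of `γ` with number `rk Eᵢ`. -/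
def mu (F : Filtration D.E t) (α : Fin t → ℚ) : ℚ :=
  -(Finset.univ.filter fun p : Option (Fin t) × Option (Fin t) => D.restr F p.1 p.2 ≠ 0).inf'
    ⟨(none, none), by simpa using D.restr_none_ne_zero F⟩
    fun p => F.gamma α (F.rk p.1) + F.gamma α (F.rk p.2)

variable [IsIntegral X] [IsLocallyNoetherian X]

/-- `(E, φ)` is semistable with respect to the parameter `δ`: the inequality
`P(E•, α) + δ μ(E•, α; φ) ≥ 0` holds for all weighted filtrations. -/
def IsSemistable (δ : ℚ) : Prop :=
  ∀ (t : ℕ), 1 ≤ t → ∀ (F : Filtration D.E t) (α : Fin t → ℚ), (∀ i, 0 < α i) →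
    0 ≤ F.P α + δ * D.mu F α

/-- `(E, φ)` is stable with respect to the parameter `δ`: the inequality
`P(E•, α) + δ μ(E•, α; φ) > 0` holds for all weighted filtrations. -/
def IsStable (δ : ℚ) : Prop :=
  ∀ (t : ℕ), 1 ≤ t → ∀ (F : Filtration D.E t) (α : Fin t → ℚ), (∀ i, 0 < α i) →
    0 < F.P α + δ * D.mu F α

end DecoratedBundle

end DecoratedBundles

end Decorated

end

/-!
The theorem is a statement about a convex, piecewise linear function of the weights, and the
geometry enters only through the finite set `S` of pairs of indices `(a, b)` for which `φ` does not
vanish on `E_a ⊗ E_b`.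

Let `r` be the rank of `E` and put `x_a = ∑_{i ≥ a} α_i`, so that `x` is nonincreasing and
`x_{t+1} = 0`. Then `γ_{rk E_a} = ∑ α_i rk E_i - r x_a`, and hence
`P + δ μ = ∑ α_i p_i + δ r max_{(a, b) ∈ S} (x_a + x_b)` with
`p_i = deg E rk E_i - r deg E_i - 2 δ rk E_i`
(`Decorated.Filtration.P_sub_gamma`, `Decorated.DecoratedBundle.P_add_mu`).

By homogeneity the weights may be taken to be integers. Cut `x` into the horizontal layers
`{a : x_a > θ}`, `θ = 0, 1, 2, …`; each layer is an initial segment `{a ≤ i(θ)}`, that is, the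
filtration of length one given by `E_{i(θ)}`. Let `m` be the maximum of `x_a + x_b` over `S`.
If `θ ≥ m`, then no index of the layer occurs in `S`, so that the layer has maximum `0`. The layers
`θ` and `m - 1 - θ` are taken together: they form a filtration of length at most two with weights
`1`, whose maximum over `S` is at most `2`, since `x_a > m - 1 - θ` and `(a, b) ∈ S` give
`x_b ≤ θ`. The maxima of these groups of layers thus add up to at most `m`, and the
inequality for `α` is a sum of inequalities for filtrations of length one or two
(`sum_layers_pos`). The inequality for a filtration extracted from `E•` only involves those pairs
of `S` that survive in it, so it is at least as strong as the one which is needed.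
The semistable case follows from the stable one by adding a small positive number to each `p_i`.
-/

/-! ### Pairing the layers of an integral weight -/

/-- A lower bound for a sum over an antitone sequence of layers: if the layers `θ₁` and `θ₂` have
`w`-values at least `2` and at least `1`, the sum of `w` is at least `(θ₁ + 1) + (θ₂ + 1)`. -/
lemma add_two_le_sum_of_antitone {T : ℕ} {w : Fin T → ℕ} (hw : Antitone w) {a b : Fin T}
    (ha : 2 ≤ w a) (hb : 1 ≤ w b) : (a : ℕ) + b + 2 ≤ ∑ q, w q := by
  have h : ∀ q, ((if q ≤ a then 1 else 0) + if q ≤ b then 1 else 0) ≤ w q := by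
    intro q
    have h1 : q ≤ a → w a ≤ w q := fun h => hw h
    have h2 : q ≤ b → w b ≤ w q := fun h => hw h
    split_ifs <;> grind
  have h' := Finset.sum_le_sum fun q (_ : q ∈ Finset.univ) => h q
  rw [Finset.sum_add_distrib, Finset.sum_boole, Finset.sum_boole, Finset.filter_ge_eq_Iic,
    Finset.filter_ge_eq_Iic, Fin.card_Iic, Fin.card_Iic] at h'
  simp only [Nat.cast_id] at h'
  omega

lemma succ_le_sum_of_antitone {T : ℕ} {w : Fin T → ℕ} (hw : Antitone w) {a : Fin T}
    (ha : 1 ≤ w a) : (a : ℕ) + 1 ≤ ∑ q, w q := by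
  have h : ∀ q, (if q ≤ a then 1 else 0) ≤ w q := by
    intro q
    have h1 : q ≤ a → w a ≤ w q := fun h => hw h
    split_ifs <;> grind
  have h' := Finset.sum_le_sum fun q (_ : q ∈ Finset.univ) => h q
  rw [Finset.sum_boole, Finset.filter_ge_eq_Iic, Fin.card_Iic] at h'
  simpa using h'

/-- The positivity criterion for a sequence of layers `G`. Here `W s i ∈ {0, 1, 2}` is the value of
the layer `i` at the pair `s`. The layers `θ` and `m - 1 - θ` together contribute at most `2` at
each pair, and the layers `θ ≥ m` contribute nothing. -/
theorem sum_layers_pos {ι σ : Type*} [LinearOrder ι] {T m : ℕ} {G : Fin T → ι} (hG : Antitone G)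
    (hT : 0 < T) {S : Finset σ} {W : σ → ι → ℕ} (hW : ∀ s, Monotone (W s))
    (hW2 : ∀ s i, W s i ≤ 2) {p : ι → ℚ} {κ : ℚ} (hκ : 0 < κ)
    (h1 : ∀ i, ∃ s ∈ S, 0 < p i + κ * W s i)
    (h2 : ∀ i j, i < j → ∃ s ∈ S, 0 < p i + p j + κ * (W s i + W s j))
    (hm : ∀ s ∈ S, ∑ q, W s (G q) ≤ m) :
    0 < ∑ q, p (G q) + κ * m := by
  have hanti : ∀ s, Antitone fun q => W s (G q) := fun s => (hW s).comp_antitone hG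
  have hpair : ∀ i j, (∀ s ∈ S, W s i + W s j ≤ 2) → 0 < p i + p j + 2 * κ := by
    intro i j hij
    have key : ∀ i j, i < j → (∀ s ∈ S, W s i + W s j ≤ 2) → 0 < p i + p j + 2 * κ := by
      intro i j hlt hij
      obtain ⟨s, hs, hpos⟩ := h2 i j hlt
      have : ((W s i + W s j : ℕ) : ℚ) ≤ 2 := by exact_mod_cast hij s hs
      push_cast at this
      nlinarith
    rcases lt_trichotomy i j with h | rfl | h
    · exact key i j h hij
    · obtain ⟨s, hs, hpos⟩ := h1 i
      have : (W s i : ℚ) ≤ 1 := by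
        have := hij s hs
        exact_mod_cast (by omega : W s i ≤ 1)
      nlinarith
    · have := key j i h fun s hs => by rw [add_comm]; exact hij s hs
      linarith
  have hone : ∀ i, 0 < p i + 2 * κ := by
    intro i
    obtain ⟨s, -, hpos⟩ := h1 i
    have : (W s i : ℚ) ≤ 2 := by exact_mod_cast hW2 s i
    nlinarith
  -- the sequence of the `p (G θ)`, continued by zero, so that `m` may exceed `T`
  let Q : ℕ → ℚ := fun θ => if h : θ < T then p (G ⟨θ, h⟩) else 0
  have hlow : ∀ θ ∈ Finset.range m, 0 < Q θ + Q (m - 1 - θ) + 2 * κ := by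
    intro θ hθ
    rw [Finset.mem_range] at hθ
    by_cases ha : θ < T <;> by_cases hb : m - 1 - θ < T <;> simp only [Q, ha, hb, dif_pos, dif_neg,
      not_false_eq_true]
    · apply hpair
      intro s hs
      by_contra! hcon
      have e1 := hW2 s (G ⟨θ, ha⟩)
      have e2 := hW2 s (G ⟨m - 1 - θ, hb⟩)
      have hms := hm s hs
      rcases Nat.lt_or_ge (W s (G ⟨θ, ha⟩)) 2 with h | h
      · have := add_two_le_sum_of_antitone (hanti s) (a := ⟨m - 1 - θ, hb⟩) (b := ⟨θ, ha⟩)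
          (show 2 ≤ W s _ by omega) (show 1 ≤ W s _ by omega)
        simp only at this
        omega
      · have := add_two_le_sum_of_antitone (hanti s) (a := ⟨θ, ha⟩) (b := ⟨m - 1 - θ, hb⟩)
          h (show 1 ≤ W s _ by omega)
        simp only at this
        omega
    · linarith [hone (G ⟨θ, ha⟩)]
    · linarith [hone (G ⟨m - 1 - θ, hb⟩)]
    · linarith
  have hhigh : ∀ θ, m ≤ θ → θ < T → 0 < Q θ := by
    intro θ hmθ hθ
    simp only [Q, hθ, dif_pos]
    obtain ⟨s, hs, hpos⟩ := h1 (G ⟨θ, hθ⟩)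
    have h0 : W s (G ⟨θ, hθ⟩) = 0 := by
      by_contra hcon
      have := succ_le_sum_of_antitone (hanti s) (a := ⟨θ, hθ⟩)
        (show 1 ≤ W s _ by omega)
      have := hm s hs
      simp only at *
      omega
    simpa [h0] using hpos
  have hdouble : 2 * (∑ θ ∈ Finset.range m, Q θ + κ * m) =
      ∑ θ ∈ Finset.range m, (Q θ + Q (m - 1 - θ) + 2 * κ) := by
    rw [Finset.sum_add_distrib, Finset.sum_add_distrib, Finset.sum_range_reflect, Finset.sum_const,
      Finset.card_range, nsmul_eq_mul]
    ring
  have hsum : ∑ q, p (G q) = ∑ θ ∈ Finset.range T, Q θ := by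
    rw [Finset.sum_range]
    exact Finset.sum_congr rfl fun q _ => by simp [Q]
  rw [hsum]
  rcases Nat.lt_or_ge m T with hmT | hTm
  · rw [← Finset.sum_range_add_sum_Ico Q hmT.le]
    have hA : 0 ≤ ∑ θ ∈ Finset.range m, (Q θ + Q (m - 1 - θ) + 2 * κ) :=
      Finset.sum_nonneg fun θ hθ => (hlow θ hθ).le
    have hB : 0 < ∑ θ ∈ Finset.Ico m T, Q θ :=
      Finset.sum_pos (fun θ hθ => hhigh θ (Finset.mem_Ico.1 hθ).1 (Finset.mem_Ico.1 hθ).2)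
        ⟨m, Finset.mem_Ico.2 ⟨le_rfl, hmT⟩⟩
    linarith
  · have hA : 0 < ∑ θ ∈ Finset.range m, (Q θ + Q (m - 1 - θ) + 2 * κ) :=
      Finset.sum_pos hlow ⟨0, Finset.mem_range.2 (hT.trans_le hTm)⟩
    have hB : ∑ θ ∈ Finset.range T, Q θ = ∑ θ ∈ Finset.range m, Q θ :=
      Finset.sum_subset (Finset.range_mono hTm) fun θ _ hθ => by
        simp only [Finset.mem_range] at hθ
        simp [Q, hθ]
    linarith

/-! ### Integral and rational weights -/

/-- A multiplicity function on a finite linear order is the fibre count of an antitone sequence. -/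
theorem exists_antitone_sum_eq {ι : Type*} [LinearOrder ι] [Fintype ι] (n : ι → ℕ) :
    ∃ G : Fin (∑ i, n i) → ι, Antitone G ∧
      ∀ {M : Type} [AddCommMonoid M] (f : ι → M), ∑ q, f (G q) = ∑ i, n i • f i := by
  let e : Fin (∑ i, n i) ≃o Σₗ i, Fin (n i) :=
    Fintype.orderIsoFinOfCardEq _ (by
      change Fintype.card (Σ i, Fin (n i)) = _
      simp)
  refine ⟨fun q => (ofLex (e q.rev)).1, ?_, ?_⟩
  · intro a b hab
    have h : e b.rev ≤ e a.rev := e.monotone (Fin.rev_le_rev.2 hab)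
    rcases Sigma.Lex.le_def.1 h with h | ⟨h, -⟩
    exacts [h.le, h.le]
  · intro M _ f
    refine (Fintype.sum_equiv (Fin.revPerm.trans (e.toEquiv.trans ofLex)) _
      (fun z : Σ i, Fin (n i) => f z.1) fun q => rfl).trans ?_
    rw [Fintype.sum_sigma]
    simp

lemma exists_pos_nat_mul_eq_natCast {ι : Type*} [Fintype ι] {α : ι → ℚ} (hα : ∀ i, 0 ≤ α i) :
    ∃ d : ℕ, 0 < d ∧ ∃ n : ι → ℕ, ∀ i, (n i : ℚ) = d * α i := by
  refine ⟨∏ i, (α i).den, Finset.prod_pos fun i _ => (α i).den_pos, ?_⟩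
  suffices h : ∀ i, ∃ n : ℕ, (n : ℚ) = (∏ i, (α i).den : ℕ) * α i from
    ⟨_, fun i => (h i).choose_spec⟩
  intro i
  obtain ⟨e, he⟩ := Finset.dvd_prod_of_mem (fun i => (α i).den) (Finset.mem_univ i)
  refine ⟨e * (α i).num.toNat, ?_⟩
  have h1 : (((α i).num.toNat : ℤ) : ℚ) = (α i).num := by
    rw [Int.toNat_of_nonneg (Rat.num_nonneg.2 (hα i))]
  have h2 : (α i) * (α i).den = (α i).num := Rat.mul_den_eq_num _
  rw [he]
  push_cast at h1 ⊢
  rw [h1, ← h2]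
  ring

/-- Positivity of `∑ α_i p_i + κ max_{s ∈ S} ∑ α_i W_s(i)` for the weights `e_i` and `e_i + e_j`
implies positivity for all positive weights. -/
theorem exists_pos_of_weights {ι σ : Type*} [LinearOrder ι] [Fintype ι] [Nonempty ι]
    {S : Finset σ} {W : σ → ι → ℕ} (hW : ∀ s, Monotone (W s))
    (hW2 : ∀ s i, W s i ≤ 2) {p : ι → ℚ} {κ : ℚ} (hκ : 0 < κ)
    (h1 : ∀ i, ∃ s ∈ S, 0 < p i + κ * W s i)
    (h2 : ∀ i j, i < j → ∃ s ∈ S, 0 < p i + p j + κ * (W s i + W s j))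
    {α : ι → ℚ} (hα : ∀ i, 0 < α i) :
    ∃ s ∈ S, 0 < ∑ i, α i * p i + κ * ∑ i, α i * W s i := by
  obtain ⟨d, hd, n, hn⟩ := exists_pos_nat_mul_eq_natCast fun i => (hα i).le
  have hd' : (0 : ℚ) < d := by exact_mod_cast hd
  obtain ⟨G, hG, hsum⟩ := exists_antitone_sum_eq n
  obtain ⟨i₀⟩ := ‹Nonempty ι›
  have hT : 0 < ∑ i, n i := by
    refine Finset.sum_pos (fun i _ => ?_) ⟨i₀, Finset.mem_univ _⟩
    have : (0 : ℚ) < n i := by rw [hn]; exact mul_pos hd' (hα i)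
    exact_mod_cast this
  obtain ⟨s₁, hs₁, -⟩ := h1 i₀
  obtain ⟨s, hs, hmax⟩ := S.exists_max_image (fun s => ∑ q, W s (G q)) ⟨s₁, hs₁⟩
  have := sum_layers_pos hG hT hW hW2 hκ h1 h2 hmax
  refine ⟨s, hs, ?_⟩
  rw [hsum p, hsum (W s)] at this
  push_cast [nsmul_eq_mul, smul_eq_mul, hn] at this
  simp only [mul_assoc, ← Finset.mul_sum] at this
  refine (mul_pos_iff_of_pos_left hd').1 ?_
  linarith

/-- The weak version of `exists_pos_of_weights`, obtained from it by raising every `p i` by an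
arbitrary `ε > 0`. -/
theorem exists_nonneg_of_weights {ι σ : Type*} [LinearOrder ι] [Fintype ι] [Nonempty ι]
    {S : Finset σ} {W : σ → ι → ℕ} (hW : ∀ s, Monotone (W s))
    (hW2 : ∀ s i, W s i ≤ 2) {p : ι → ℚ} {κ : ℚ} (hκ : 0 < κ)
    (h1 : ∀ i, ∃ s ∈ S, 0 ≤ p i + κ * W s i)
    (h2 : ∀ i j, i < j → ∃ s ∈ S, 0 ≤ p i + p j + κ * (W s i + W s j))
    {α : ι → ℚ} (hα : ∀ i, 0 < α i) :
    ∃ s ∈ S, 0 ≤ ∑ i, α i * p i + κ * ∑ i, α i * W s i := by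
  obtain ⟨s₁, hs₁, -⟩ := h1 (Classical.arbitrary ι)
  obtain ⟨s, hs, hmax⟩ := S.exists_max_image (fun s => ∑ i, α i * (W s i : ℚ)) ⟨s₁, hs₁⟩
  refine ⟨s, hs, ?_⟩
  have hA : 0 < ∑ i, α i := Finset.sum_pos (fun i _ => hα i) Finset.univ_nonempty
  by_contra! hneg
  set v := ∑ i, α i * p i + κ * ∑ i, α i * W s i with hv
  -- raising `p` by `ε` raises the value at `α` by `ε * ∑ α i`, which is `-v` for this `ε`
  obtain ⟨ε, hε, hεv⟩ : ∃ ε : ℚ, 0 < ε ∧ (∑ i, α i) * ε = -v :=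
    ⟨-v / ∑ i, α i, div_pos (by linarith) hA, by field_simp⟩
  obtain ⟨s', hs', hpos⟩ := exists_pos_of_weights (p := fun i => p i + ε) hW hW2 hκ
    (fun i => (h1 i).imp fun s h => ⟨h.1, by linarith [h.2]⟩)
    (fun i j hij => (h2 i j hij).imp fun s h => ⟨h.1, by linarith [h.2]⟩) hα
  have hle := mul_le_mul_of_nonneg_left (hmax s' hs') hκ.le
  simp only [mul_add, Finset.sum_add_distrib, ← Finset.sum_mul] at hpos
  linarith

namespace Decorated

variable {X : Scheme.{u}}

/-! ### Weights of a filtration and extracted filtrations -/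

namespace Filtration

variable {E : VectorBundle X} {t : ℕ} (F : Filtration E t)

/-- The number of members of the pair `(E_a, E_b)` which are contained in `E_i`: the sum of the
values at `a` and at `b` of the indicator function of `{a ≤ i}`. -/
def pairCount (s : Option (Fin t) × Option (Fin t)) (i : Fin t) : ℕ :=
  (if F.rk s.1 ≤ (F.sub i).rank then 1 else 0) + if F.rk s.2 ≤ (F.sub i).rank then 1 else 0

lemma pairCount_monotone (s : Option (Fin t) × Option (Fin t)) : Monotone (F.pairCount s) := by
  intro i j hij
  have h : (F.sub i).rank ≤ (F.sub j).rank := F.rank_strictMono.monotone hij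
  unfold pairCount
  split_ifs <;> omega

lemma pairCount_le_two (s : Option (Fin t) × Option (Fin t)) (i : Fin t) :
    F.pairCount s i ≤ 2 := by
  unfold pairCount
  split_ifs <;> omega

/-- The filtration consisting of the members of `F` with indices `g 0 < g 1 < ⋯`. -/
def extract {n : ℕ} (g : Fin n → Fin t) (hg : StrictMono g) : Filtration E n where
  sub i := F.sub (g i)
  mono _ _ hij := F.mono _ _ (hg.monotone hij)
  rank_pos _ := F.rank_pos _
  rank_strictMono := F.rank_strictMono.comp hg
  rank_lt _ := F.rank_lt _

lemma extract_pairCount {n : ℕ} (g : Fin n → Fin t) (hg : StrictMono g)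
    (s : Option (Fin n) × Option (Fin n)) (i : Fin n) :
    (F.extract g hg).pairCount s i = F.pairCount (s.1.map g, s.2.map g) (g i) := by
  obtain ⟨_ | a, _ | b⟩ := s <;> rfl

variable [IsIntegral X] [IsLocallyNoetherian X]

/-- The coefficient of `α_i` in `P + δ μ` apart from the contribution of the pairs on which `φ` is
nonzero. -/
noncomputable def coeff (δ : ℚ) (i : Fin t) : ℚ :=
  (E.degree : ℚ) * (F.sub i).rank - E.rank * (F.sub i).degree - 2 * δ * (F.sub i).rank

/-- The contribution of a pair `s` to the maximum defining `P + δ μ`, as a linear form in the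
weights. -/
lemma P_sub_gamma (δ : ℚ) (α : Fin t → ℚ) (s : Option (Fin t) × Option (Fin t)) :
    F.P α + δ * -(F.gamma α (F.rk s.1) + F.gamma α (F.rk s.2)) =
      ∑ i, α i * F.coeff δ i + δ * E.rank * ∑ i, α i * F.pairCount s i := by
  unfold P gamma
  rw [← Finset.sum_add_distrib, ← Finset.sum_neg_distrib, Finset.mul_sum, Finset.mul_sum,
    ← Finset.sum_add_distrib, ← Finset.sum_add_distrib]
  refine Finset.sum_congr rfl fun i _ => ?_
  unfold coeff pairCount
  split_ifs <;> push_cast <;> ring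

end Filtration

namespace DecoratedBundle

variable {b c : ℕ} {N : X.Modules} (D : DecoratedBundle X b c N) {t : ℕ} (F : Filtration D.E t)

lemma restr_extract {n : ℕ} (g : Fin n → Fin t) (hg : StrictMono g) (i j : Option (Fin n)) :
    D.restr (F.extract g hg) i j ≠ 0 ↔ D.restr F (i.map g) (j.map g) ≠ 0 := by
  cases i <;> cases j <;> exact Iff.rfl

open Classical in
/-- The pairs of indices `(i, j)` such that `φ` is not identically zero on `(E_i ⊗ E_j)^{⊕ b}`. -/
noncomputable def nonzeroPairs : Finset (Option (Fin t) × Option (Fin t)) :=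
  Finset.univ.filter fun p => D.restr F p.1 p.2 ≠ 0

lemma mem_nonzeroPairs {s : Option (Fin t) × Option (Fin t)} :
    s ∈ D.nonzeroPairs F ↔ D.restr F s.1 s.2 ≠ 0 := by
  simp [nonzeroPairs]

variable [IsIntegral X] [IsLocallyNoetherian X]

/-- `P + δ μ` as a maximum of linear forms in the weights, attained by some pair. -/
lemma P_add_mu {δ : ℚ} (hδ : 0 < δ) (α : Fin t → ℚ) :
    (∀ s ∈ D.nonzeroPairs F, ∑ i, α i * F.coeff δ i + δ * D.E.rank * ∑ i, α i * F.pairCount s i ≤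
      F.P α + δ * D.mu F α) ∧
    ∃ s ∈ D.nonzeroPairs F, F.P α + δ * D.mu F α =
      ∑ i, α i * F.coeff δ i + δ * D.E.rank * ∑ i, α i * F.pairCount s i := by
  constructor
  · intro s hs
    rw [← F.P_sub_gamma]
    refine add_le_add_right (mul_le_mul_of_nonneg_left (neg_le_neg ?_) hδ.le) _
    exact Finset.inf'_le (f := fun p : Option (Fin t) × Option (Fin t) =>
      F.gamma α (F.rk p.1) + F.gamma α (F.rk p.2)) hs
  · obtain ⟨s, hs, h⟩ := Finset.exists_mem_eq_inf' (s := D.nonzeroPairs F)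
      ⟨(none, none), (D.mem_nonzeroPairs F).2 (D.restr_none_ne_zero F)⟩
      fun p => F.gamma α (F.rk p.1) + F.gamma α (F.rk p.2)
    refine ⟨s, hs, ?_⟩
    rw [← F.P_sub_gamma, ← h]
    rfl

/-- The value of `P + δ μ` on a filtration extracted from `F`, with all weights equal to `1`, is
attained at a pair of members of `F`. -/
lemma exists_P_add_mu_extract {δ : ℚ} (hδ : 0 < δ) {n : ℕ} (g : Fin n → Fin t)
    (hg : StrictMono g) :
    ∃ s ∈ D.nonzeroPairs F,
      (F.extract g hg).P (fun _ => 1) + δ * D.mu (F.extract g hg) (fun _ => 1) =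
        ∑ i, F.coeff δ (g i) + δ * D.E.rank * ∑ i, (F.pairCount s (g i) : ℚ) := by
  obtain ⟨s, hs, h⟩ := (D.P_add_mu (F.extract g hg) hδ fun _ => 1).2
  refine ⟨(s.1.map g, s.2.map g), ?_, ?_⟩
  · rw [mem_nonzeroPairs] at hs ⊢
    exact (D.restr_extract F g hg _ _).1 hs
  · rw [h]
    simp only [one_mul, F.extract_pairCount]
    rfl

lemma exists_P_add_mu_extract_one {δ : ℚ} (hδ : 0 < δ) (i : Fin t) :
    ∃ F' : Filtration D.E 1, ∃ s ∈ D.nonzeroPairs F,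
      F'.P (fun _ => 1) + δ * D.mu F' (fun _ => 1) =
        F.coeff δ i + δ * D.E.rank * F.pairCount s i := by
  obtain ⟨s, hs, h⟩ := D.exists_P_add_mu_extract F hδ ![i] (Subsingleton.strictMono _)
  exact ⟨_, s, hs, by simpa using h⟩

lemma exists_P_add_mu_extract_two {δ : ℚ} (hδ : 0 < δ) {i j : Fin t} (hij : i < j) :
    ∃ F' : Filtration D.E 2, ∃ s ∈ D.nonzeroPairs F,
      F'.P (fun _ => 1) + δ * D.mu F' (fun _ => 1) =
        F.coeff δ i + F.coeff δ j + δ * D.E.rank * (F.pairCount s i + F.pairCount s j) := by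
  obtain ⟨s, hs, h⟩ := D.exists_P_add_mu_extract F hδ ![i, j]
    (Fin.strictMono_iff_lt_succ.2 fun k => by fin_cases k; simpa using hij)
  exact ⟨_, s, hs, by simpa [Fin.sum_univ_two] using h⟩

end DecoratedBundle

end Decorated

/-! ### The criterion -/

theorem theorem1 {k : Type u} [Field k] [IsAlgClosed k] (C : Decorated.SmoothProjectiveCurve k)
    (b c : ℕ) (N : C.X.Modules) (hN : Decorated.IsLocallyFreeOfRank N 1)
    (D : Decorated.DecoratedBundle C.X b c N) (δ : ℚ) (hδ : 0 < δ) :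
    (D.IsSemistable δ ↔
      ∀ (t : ℕ), 1 ≤ t → t ≤ 2 → ∀ F : Decorated.Filtration D.E t,
        0 ≤ F.P (fun _ => 1) + δ * D.mu F (fun _ => 1)) ∧
    (D.IsStable δ ↔
      ∀ (t : ℕ), 1 ≤ t → t ≤ 2 → ∀ F : Decorated.Filtration D.E t,
        0 < F.P (fun _ => 1) + δ * D.mu F (fun _ => 1)) := by
  have hκ : ∀ {t : ℕ}, 1 ≤ t → Decorated.Filtration D.E t → 0 < δ * (D.E.rank : ℚ) := by
    intro t ht F
    have : 0 < D.E.rank := (Nat.zero_le _).trans_lt (F.rank_lt ⟨0, ht⟩)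
    exact mul_pos hδ (by exact_mod_cast this)
  refine ⟨⟨fun h t ht _ F => h t ht F _ fun _ => one_pos, fun h t ht F α hα => ?_⟩,
    ⟨fun h t ht _ F => h t ht F _ fun _ => one_pos, fun h t ht F α hα => ?_⟩⟩
  · have : Nonempty (Fin t) := ⟨⟨0, ht⟩⟩
    obtain ⟨s, hs, hpos⟩ := exists_nonneg_of_weights (S := D.nonzeroPairs F) (p := F.coeff δ)
      F.pairCount_monotone F.pairCount_le_two (hκ ht F)
      (fun i => by
        obtain ⟨F', s, hs, e⟩ := D.exists_P_add_mu_extract_one F hδ i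
        exact ⟨s, hs, e ▸ h 1 le_rfl one_le_two F'⟩)
      (fun i j hij => by
        obtain ⟨F', s, hs, e⟩ := D.exists_P_add_mu_extract_two F hδ hij
        exact ⟨s, hs, e ▸ h 2 one_le_two le_rfl F'⟩) hα
    exact hpos.trans ((D.P_add_mu F hδ α).1 s hs)
  · have : Nonempty (Fin t) := ⟨⟨0, ht⟩⟩
    obtain ⟨s, hs, hpos⟩ := exists_pos_of_weights (S := D.nonzeroPairs F) (p := F.coeff δ)
      F.pairCount_monotone F.pairCount_le_two (hκ ht F)
      (fun i => by
        obtain ⟨F', s, hs, e⟩ := D.exists_P_add_mu_extract_one F hδ i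
        exact ⟨s, hs, e ▸ h 1 le_rfl one_le_two F'⟩)
      (fun i j hij => by
        obtain ⟨F', s, hs, e⟩ := D.exists_P_add_mu_extract_two F hδ hij
        exact ⟨s, hs, e ▸ h 2 one_le_two le_rfl F'⟩) hα
    exact hpos.trans_le ((D.P_add_mu F hδ α).1 s hs)
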